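/- Let $S\subset\mathbb R^N$ be compact, let $\mathcal M(S)^N$ be the space of $\mathbb R^N$-valued finite Borel measures on $S$ with total variation norm $\|\cdot\|_{TV}$ (taken with respect to the Euclidean norm $|\cdot|$), paired with $C(S)^N$ by $\langle\varphi,\mu\rangle=\int\varphi\cdot d\mu$. Let $\mathcal H$ be a real Hilbert space (for instance $L^2(Q)$) and let $A:\mathcal M(S)^N\to\mathcal H$ be a weak-star continuous linear operator, in the sense that $\mu\mapsto\langle g,A\mu\rangle_{\mathcal H}$ is weak-star continuous for every $g\in\mathcal H$; let $A^*:\mathcal H\to C(S)^N$ be its adjoint, $\langle A^*g,\mu\rangle=\langle g,A\mu\rangle_{\mathcal H}$. Let $I$ be a finite set, let $\nu_k$ ($k\in I$) be pairwise mutually singular Borel probability measures on $S$, and let $V=\{\sum_{k\in I}m_k\nu_k : m_k\in\mathbb R^N\}$. Assume that $A$ is injective on $V$. For $f\in\mathcal H$ and $\lambda>0$ put $\mathcal F_{\lambda,f}(\mu)=\|f-A\mu\|_{\mathcal H}^2+\lambda\|\mu\|_{TV}$. Then for all $f\in\mathcal H$ and $\lambda>0$ the functional $\mathcal F_{\lambda,f}$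 has a unique minimizer $\mu_{\lambda,f}=\sum_{k\in I}m_k^{\lambda,f}\nu_k$ over $V$, with uniquely determined coefficients $m_k^{\lambda,f}\in\mathbb R^N$. Moreover, there is a dense residual (comeagre) subset $\mathcal O$ of $\mathcal H\times(0,\infty)$ such that for every $(f,\lambda)\in\mathcal O$ $$\Big\{k\in I : \big|\langle\nu_k,A^*(f-A\mu_{\lambda,f})\rangle\big|=\tfrac{\lambda}{2}\Big\}=\{k\in I : m_k^{\lambda,f}\neq0\},$$ where $\langle\nu_k,\varphi\rangle=\int\varphi\,d\nu_k\in\mathbb R^N$ for $\varphi\in C(S)^N$. -/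

import Mathlib

open MeasureTheory Set
open scoped ENNReal

noncomputable section

namespace TVReg

/-- `ℝ^N` with its Euclidean norm. -/
abbrev Euc (N : ℕ) : Type := EuclideanSpace ℝ (Fin N)

/-- `𝓜(S)^N`: the `ℝ^N`-valued (countably additive) Borel measures on `S ⊆ ℝ^N`. A vector measure
takes its values in `ℝ^N`, so its components are finite signed measures. -/
abbrev VMeas {N : ℕ} (S : Set (Euc N)) : Type := VectorMeasure S (Euc N)

variable {N : ℕ} {S : Set (Euc N)}

/-- The total variation measure `|μ|` (taken with the Euclidean norm) is finite. -/
theorem isFiniteMeasure_variation (μ : VMeas S) : IsFiniteMeasure μ.variation := by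
  let π : Fin N → Euc N →ₗ[ℝ] ℝ := fun i => (EuclideanSpace.proj (𝕜 := ℝ) i).toLinearMap
  have hπ : ∀ i, Continuous (π i) := fun i => (EuclideanSpace.proj (𝕜 := ℝ) i).continuous
  let c : Fin N → SignedMeasure S := fun i => VectorMeasure.mapRangeₗ (π i) (hπ i) μ
  have hc : ∀ i, IsFiniteMeasure (c i).variation := by
    intro i
    rw [← SignedMeasure.totalVariation_eq_variation]
    unfold SignedMeasure.totalVariation
    infer_instance
  have hle : μ.variation ≤ ∑ i, (c i).variation := by
    apply VectorMeasure.variation_le_of_forall_enorm_le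
    intro E _
    rw [Measure.finsetSum_apply]
    have h1 : μ E = ∑ i, EuclideanSpace.single i (c i E) := by
      ext j
      simp only [WithLp.ofLp_sum, Finset.sum_apply, PiLp.single_apply, Finset.sum_ite_eq,
        Finset.mem_univ, if_true]
      rfl
    rw [h1]
    refine (enorm_sum_le _ _).trans (Finset.sum_le_sum fun i _ => ?_)
    refine le_trans (le_of_eq ?_) (VectorMeasure.enorm_measure_le_variation (c i) E)
    simp [enorm_eq_nnnorm]
  exact isFiniteMeasure_of_le _ hle

/-- The total variation norm `‖μ‖_TV = |μ|(S)`. -/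
def tvNorm (μ : VMeas S) : ℝ := (μ.variation univ).toReal

theorem integrable_continuous [CompactSpace S] (μ : VMeas S) (φ : C(S, Euc N)) :
    μ.Integrable φ := by
  have := isFiniteMeasure_variation μ
  exact φ.continuous.integrable_of_hasCompactSupport (HasCompactSupport.of_compactSpace _)

/-- The duality pairing `⟨φ, μ⟩ = ∫ φ · dμ` between `𝓜(S)^N` and `C(S)^N`, where the dot is the
Euclidean scalar product. -/
def pairing (S : Set (Euc N)) [CompactSpace S] : VMeas S →ₗ[ℝ] C(S, Euc N) →ₗ[ℝ] ℝ :=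
  LinearMap.mk₂ ℝ (fun μ φ => μ.integral φ (innerSL ℝ))
    (fun μ ν φ => VectorMeasure.integral_add_vectorMeasure
      (integrable_continuous μ φ) (integrable_continuous ν φ))
    (fun c _ φ => VectorMeasure.integral_smul_vectorMeasure φ c)
    (fun μ φ ψ => VectorMeasure.integral_add
      (integrable_continuous μ φ) (integrable_continuous μ ψ))
    (fun _ μ φ => VectorMeasure.integral_smul (f := φ) μ (innerSL ℝ) _)

variable {H : Type*} [NormedAddCommGroup H] [InnerProductSpace ℝ H]

/-- Weak-star continuity of a linear operator `A : 𝓜(S)^N → H`: for every `g ∈ H`, the functional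
`μ ↦ ⟨g, A μ⟩` is continuous for the weak-star topology `σ(𝓜(S)^N, C(S)^N)`. -/
def WeakStarContinuous [CompactSpace S] (A : VMeas S →ₗ[ℝ] H) : Prop :=
  ∀ g : H, Continuous fun μ : WeakBilin (pairing S) => (inner ℝ g (A μ) : ℝ)

theorem exists_adjoint [CompactSpace S] {A : VMeas S →ₗ[ℝ] H} (hA : WeakStarContinuous A)
    (g : H) : ∃ φ : C(S, Euc N), ∀ μ : VMeas S, pairing S μ φ = inner ℝ g (A μ) := by
  let L : StrongDual ℝ (WeakBilin (pairing S)) :=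
    { toFun := fun μ => inner ℝ g (A μ)
      map_add' := fun μ ν => (congrArg (inner ℝ g) (A.map_add μ ν)).trans (inner_add_right _ _ _)
      map_smul' := fun c μ =>
        (congrArg (inner ℝ g) (A.map_smul c μ)).trans (real_inner_smul_right _ _ _)
      cont := hA g }
  obtain ⟨φ, hφ⟩ := LinearMap.dualEmbedding_surjective (pairing S) L
  exact ⟨φ, fun μ => congrArg (fun T : StrongDual ℝ (WeakBilin (pairing S)) => T μ) hφ⟩

/-- The adjoint `A* : H → C(S)^N` of a weak-star continuous linear operator `A : 𝓜(S)^N → H`,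
determined by `⟨A* g, μ⟩ = ⟨g, A μ⟩_H` for all `μ`. -/
def adjoint [CompactSpace S] {A : VMeas S →ₗ[ℝ] H} (hA : WeakStarContinuous A) (g : H) :
    C(S, Euc N) :=
  (exists_adjoint hA g).choose

theorem pairing_adjoint [CompactSpace S] {A : VMeas S →ₗ[ℝ] H} (hA : WeakStarContinuous A)
    (g : H) (μ : VMeas S) : pairing S μ (adjoint hA g) = inner ℝ g (A μ) :=
  (exists_adjoint hA g).choose_spec μ

/-- A function in `C(S)^N` is determined by its pairings with measures, so `adjoint` does not
depend on the choice made in its definition. -/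
theorem pairing_right_injective [CompactSpace S] {φ ψ : C(S, Euc N)}
    (h : ∀ μ : VMeas S, pairing S μ φ = pairing S μ ψ) : φ = ψ := by
  ext1 x
  refine ext_inner_right ℝ fun v => ?_
  have := h (VectorMeasure.dirac x v)
  simp only [pairing, LinearMap.mk₂_apply, VectorMeasure.integral_dirac] at this
  exact this

/-- The regularized functional `𝓕_{λ,f}(μ) = ‖f - A μ‖² + λ ‖μ‖_TV`. -/
def objective (A : VMeas S →ₗ[ℝ] H) (lam : ℝ) (f : H) (μ : VMeas S) : ℝ :=
  ‖f - A μ‖ ^ 2 + lam * tvNorm μ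

/-- `μ` is a minimizer of `𝓕_{λ,f}` over `V`. -/
def IsMinimizer (A : VMeas S →ₗ[ℝ] H) (V : Submodule ℝ (VMeas S)) (lam : ℝ) (f : H)
    (μ : VMeas S) : Prop :=
  μ ∈ V ∧ ∀ μ' ∈ V, objective A lam f μ ≤ objective A lam f μ'

variable {ι : Type*}

/-- Generating measures of a GSM space: mutually singular Borel probability measures on `S`. -/
structure IsGenerating (ν : ι → Measure S) : Prop where
  prob : ∀ k, IsProbabilityMeasure (ν k)
  singular : Pairwise fun j k => Measure.MutuallySingular (ν j) (ν k)

/-- The vector measure `∑ k, m k • ν k`, for a finite family of coefficients `m k ∈ ℝ^N`: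
each summand is the measure with constant density `m k` with respect to `ν k`. -/
def comb [Fintype ι] (ν : ι → Measure S) (m : ι → Euc N) : VMeas S :=
  ∑ k, (ν k).withDensityᵥ fun _ => m k

/-- The value of `∑ k, m k • ν k` on a Borel set. -/
theorem comb_apply [Fintype ι] {ν : ι → Measure S} (hν : IsGenerating ν) (m : ι → Euc N)
    {E : Set S} (hE : MeasurableSet E) : comb ν m E = ∑ k, (ν k).real E • m k := by
  have := hν.prob
  simp [comb, withDensityᵥ_apply (integrable_const _) hE]

theorem comb_add [Fintype ι] {ν : ι → Measure S} (hν : IsGenerating ν) (m m' : ι → Euc N) :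
    comb ν (m + m') = comb ν m + comb ν m' := by
  ext1 E hE
  simp [comb_apply hν _ hE, Finset.sum_add_distrib]

theorem comb_smul [Fintype ι] {ν : ι → Measure S} (hν : IsGenerating ν) (c : ℝ) (m : ι → Euc N) :
    comb ν (c • m) = c • comb ν m := by
  ext1 E hE
  simp [comb_apply hν _ hE, Finset.smul_sum, smul_comm c]

/-- The GSM space `V = {∑ k, m k • ν k : m k ∈ ℝ^N}` with finitely many generating measures. -/
def gsmSpace [Fintype ι] {ν : ι → Measure S} (hν : IsGenerating ν) : Submodule ℝ (VMeas S) where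
  carrier := range (comb ν)
  add_mem' := by
    rintro _ _ ⟨m, rfl⟩ ⟨m', rfl⟩
    exact ⟨m + m', comb_add hν m m'⟩
  zero_mem' := ⟨0, by ext1 E hE; simp [comb_apply hν _ hE]⟩
  smul_mem' := by
    rintro c _ ⟨m, rfl⟩
    exact ⟨c • m, comb_smul hν c m⟩

/-- `L_α(μ) = {k : |⟨ν k, A*(f - A μ)⟩| = α}`, where `⟨ν k, φ⟩ = ∫ φ dν k ∈ ℝ^N` for `φ ∈ C(S)^N`
and `|·|` is the Euclidean norm. -/
def levelSet [CompactSpace S] {A : VMeas S →ₗ[ℝ] H} (hA : WeakStarContinuous A)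
    (ν : ι → Measure S) (f : H) (α : ℝ) (μ : VMeas S) : Set ι :=
  {k | ‖∫ x, adjoint hA (f - A μ) x ∂(ν k)‖ = α}

end TVReg

end

/-! Mutual singularity gives `tvNorm (comb ν m) = ∑ k, ‖m k‖`, so minimizing over `V` is a
finite-dimensional group lasso for the injective map `B m = A (comb ν m)`. With `g k` the `k`-th
component of `B* (f - B m)`, optimality says `‖g k‖ ≤ λ/2` and `2⟨g k, m k⟩ = λ‖m k‖`; hence `m k ≠
0` forces `‖g k‖ = λ/2`.

The converse fails only at degenerate indices, where `‖g k‖ = λ/2` and `m k = 0`. Having none is an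
open condition, since the minimizer is continuous in `(f, λ)`. It is dense: let `u k = g k` at
degenerate indices and `0` elsewhere; replacing `f` by `f + t B u` moves the minimizer to `m + t u`
with the same residual, so no degenerate index remains. Thus `O` is even open and dense. -/

noncomputable section

namespace TVReg

/-! ### Finite-dimensional group lasso -/

section GroupLasso

open Filter Topology

variable {ι E H : Type*} [NormedAddCommGroup E] [InnerProductSpace ℝ E]
  [NormedAddCommGroup H] [InnerProductSpace ℝ H]

/-- The `k`-th component of the adjoint of `B : E^ι → H`. -/
def coordAdjoint [CompleteSpace E] [CompleteSpace H] [DecidableEq ι] (B : (ι → E) →L[ℝ] H) (k : ι) : H →L[ℝ] E :=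
  ContinuousLinearMap.adjoint (B ∘L ContinuousLinearMap.single ℝ (fun _ => E) k)

theorem inner_coordAdjoint [CompleteSpace E] [CompleteSpace H] [DecidableEq ι]
    (B : (ι → E) →L[ℝ] H) (k : ι) (h : H) (v : E) :
    inner ℝ (coordAdjoint B k h) v = inner ℝ h (B (Pi.single k v)) := by
  simp [coordAdjoint, ContinuousLinearMap.adjoint_inner_left]

variable [Fintype ι]

/-- The group-lasso functional `m ↦ ‖f - B m‖² + λ ∑ k, ‖m k‖`. -/
def groupLasso (B : (ι → E) →L[ℝ] H) (lam : ℝ) (f : H) (m : ι → E) : ℝ :=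
  ‖f - B m‖ ^ 2 + lam * ∑ k, ‖m k‖

/-- `m` minimizes the group-lasso functional. -/
def IsGroupLassoMin (B : (ι → E) →L[ℝ] H) (lam : ℝ) (f : H) (m : ι → E) : Prop :=
  ∀ m', groupLasso B lam f m ≤ groupLasso B lam f m'

theorem exists_isGroupLassoMin [FiniteDimensional ℝ E] (B : (ι → E) →L[ℝ] H) {lam : ℝ}
    (hlam : 0 < lam) (f : H) : ∃ m, IsGroupLassoMin B lam f m := by
  have : ProperSpace (ι → E) := FiniteDimensional.proper ℝ _
  have hcont : Continuous (groupLasso B lam f) := by unfold groupLasso; fun_prop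
  refine hcont.exists_forall_le ?_
  refine tendsto_atTop_mono (f := fun m : ι → E => lam * ‖m‖) (fun m => ?_)
    ((tendsto_norm_cocompact_atTop).const_mul_atTop hlam)
  have h1 : ‖m‖ ≤ ∑ k, ‖m k‖ :=
    (pi_norm_le_iff_of_nonneg (Finset.sum_nonneg fun k _ => norm_nonneg _)).2 fun k =>
      Finset.single_le_sum (f := fun k => ‖m k‖) (fun k _ => norm_nonneg _) (Finset.mem_univ k)
  have h2 := mul_le_mul_of_nonneg_left h1 hlam.le
  have h3 := sq_nonneg ‖f - B m‖
  simp only [groupLasso]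
  linarith

/-- The minimizers of the group-lasso functional are the solutions of a variational inequality. -/
theorem isGroupLassoMin_iff_variational {B : (ι → E) →L[ℝ] H} {lam : ℝ} (hlam : 0 < lam) {f : H}
    {m : ι → E} : IsGroupLassoMin B lam f m ↔
      ∀ m', 2 * inner ℝ (f - B m) (B (m' - m)) ≤ lam * (∑ k, ‖m' k‖ - ∑ k, ‖m k‖) := by
  have expand : ∀ d : ι → E, ‖f - B (m + d)‖ ^ 2 =
      ‖f - B m‖ ^ 2 - 2 * inner ℝ (f - B m) (B d) + ‖B d‖ ^ 2 := by
    intro d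
    rw [map_add, ← sub_sub, norm_sub_sq_real]
  constructor
  · intro h m'
    set d := m' - m with hd
    -- Compare `m` with `m + t • d`, bound the penalty by convexity and divide by `t`; the quadratic
    -- remainder vanishes as `t → 0`.
    have key : ∀ t ∈ Ioo (0 : ℝ) 1, 2 * inner ℝ (f - B m) (B d) ≤
        lam * (∑ k, ‖m' k‖ - ∑ k, ‖m k‖) + t * ‖B d‖ ^ 2 := by
      rintro t ⟨ht0, ht1⟩
      have h1 := h (m + t • d)
      have h2 : ∑ k, ‖(m + t • d) k‖ ≤ (1 - t) * ∑ k, ‖m k‖ + t * ∑ k, ‖m' k‖ := by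
        rw [Finset.mul_sum, Finset.mul_sum, ← Finset.sum_add_distrib]
        refine Finset.sum_le_sum fun k _ => ?_
        have : (m + t • d) k = (1 - t) • m k + t • m' k := by
          simp only [hd, Pi.add_apply, Pi.smul_apply, Pi.sub_apply]; module
        rw [this]
        refine (norm_add_le _ _).trans (le_of_eq ?_)
        rw [norm_smul, norm_smul, Real.norm_of_nonneg ht0.le, Real.norm_of_nonneg (by linarith)]
      have h3 := mul_le_mul_of_nonneg_left h2 hlam.le
      simp only [groupLasso] at h1
      rw [expand, map_smul, real_inner_smul_right, norm_smul, Real.norm_of_nonneg ht0.le] at h1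
      refine le_of_mul_le_mul_left ?_ ht0
      linarith
    have hlim : Tendsto (fun t : ℝ => lam * (∑ k, ‖m' k‖ - ∑ k, ‖m k‖) + t * ‖B d‖ ^ 2) (𝓝[>] 0)
        (𝓝 (lam * (∑ k, ‖m' k‖ - ∑ k, ‖m k‖))) := by
      refine tendsto_nhdsWithin_of_tendsto_nhds ?_
      exact Continuous.tendsto' (by fun_prop) _ _ (by simp)
    refine ge_of_tendsto hlim ?_
    filter_upwards [Ioo_mem_nhdsGT (zero_lt_one (α := ℝ))] with t ht using key t ht
  · intro h m'
    have h1 := h m'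
    have h2 := expand (m' - m)
    have h3 := sq_nonneg ‖B (m' - m)‖
    rw [add_sub_cancel] at h2
    simp only [groupLasso]
    linarith

/-- The images of minimizers depend on the data in a Lipschitz way. -/
theorem IsGroupLassoMin.norm_map_sub_le {B : (ι → E) →L[ℝ] H} {K : ℝ} (hK0 : 0 ≤ K)
    (hK : ∀ m, ∑ k, ‖m k‖ ≤ K * ‖B m‖) {lam lam' : ℝ} (hlam : 0 < lam) (hlam' : 0 < lam')
    {f f' : H} {m m' : ι → E} (h : IsGroupLassoMin B lam f m) (h' : IsGroupLassoMin B lam' f' m') :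
    ‖B (m' - m)‖ ≤ ‖f' - f‖ + K / 2 * |lam' - lam| := by
  -- Each minimizer is tested against the other. In the sum, the residual terms produce `‖B (m' -
  -- m)‖ ^ 2`, one factor of which cancels.
  have h1 := (isGroupLassoMin_iff_variational hlam).1 h m'
  have h2 := (isGroupLassoMin_iff_variational hlam').1 h' m
  have h3 : |∑ k, ‖m' k‖ - ∑ k, ‖m k‖| ≤ K * ‖B (m' - m)‖ := by
    refine le_trans ?_ (hK _)
    rw [← Finset.sum_sub_distrib]
    exact (Finset.abs_sum_le_sum_abs _ _).trans
      (Finset.sum_le_sum fun k _ => abs_norm_sub_norm_le _ _)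
  have h4 : (lam - lam') * (∑ k, ‖m' k‖ - ∑ k, ‖m k‖) ≤ |lam' - lam| * (K * ‖B (m' - m)‖) := by
    refine (le_abs_self _).trans ?_
    rw [abs_mul, abs_sub_comm lam]
    exact mul_le_mul_of_nonneg_left h3 (abs_nonneg _)
  have h5 := real_inner_le_norm (f' - f) (B (m' - m))
  have h6 : inner ℝ (f - B m) (B (m' - m)) + inner ℝ (f' - B m') (B (m - m')) =
      ‖B (m' - m)‖ ^ 2 - inner ℝ (f' - f) (B (m' - m)) := by
    rw [← neg_sub m' m, map_neg, inner_neg_right, ← sub_eq_add_neg, ← inner_sub_left,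
      ← real_inner_self_eq_norm_sq, ← inner_sub_left]
    congr 1
    rw [map_sub]
    abel
  rcases (norm_nonneg (B (m' - m))).eq_or_lt with h0 | h0
  · rw [← h0]
    positivity
  · refine le_of_mul_le_mul_right ?_ h0
    nlinarith

theorem IsGroupLassoMin.unique {B : (ι → E) →L[ℝ] H} (hB : Function.Injective B) {lam : ℝ}
    (hlam : 0 < lam) {f : H} {m m' : ι → E} (h : IsGroupLassoMin B lam f m)
    (h' : IsGroupLassoMin B lam f m') : m = m' := by
  have h1 := (isGroupLassoMin_iff_variational hlam).1 h m'
  have h2 := (isGroupLassoMin_iff_variational hlam).1 h' m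
  have h6 : inner ℝ (f - B m) (B (m' - m)) + inner ℝ (f - B m') (B (m - m')) =
      ‖B (m' - m)‖ ^ 2 := by
    rw [← neg_sub m' m, map_neg, inner_neg_right, ← sub_eq_add_neg, ← inner_sub_left,
      ← real_inner_self_eq_norm_sq]
    congr 1
    rw [map_sub]
    abel
  have h7 : ‖B (m' - m)‖ = 0 := by nlinarith [norm_nonneg (B (m' - m))]
  rw [map_sub, norm_eq_zero, sub_eq_zero] at h7
  exact (hB h7).symm

variable [CompleteSpace E] [CompleteSpace H]

variable [DecidableEq ι]

theorem inner_map_eq_sum_coordAdjoint (B : (ι → E) →L[ℝ] H) (h : H) (x : ι → E) :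
    inner ℝ h (B x) = ∑ k, inner ℝ (coordAdjoint B k h) (x k) := by
  conv_lhs => rw [← Finset.univ_sum_single x, map_sum, inner_sum]
  simp only [inner_coordAdjoint]

/-- First order optimality conditions for the group-lasso functional. -/
theorem isGroupLassoMin_iff_coordAdjoint {B : (ι → E) →L[ℝ] H} {lam : ℝ} (hlam : 0 < lam) {f : H}
    {m : ι → E} : IsGroupLassoMin B lam f m ↔ ∀ k, ‖coordAdjoint B k (f - B m)‖ ≤ lam / 2 ∧
      2 * inner ℝ (coordAdjoint B k (f - B m)) (m k) = lam * ‖m k‖ := by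
  rw [isGroupLassoMin_iff_variational hlam]
  constructor
  · intro h k
    set g := coordAdjoint B k (f - B m) with hg
    have key : ∀ v : E, 2 * inner ℝ g v ≤ lam * (‖m k + v‖ - ‖m k‖) := by
      intro v
      have h1 := h (m + Pi.single k v)
      rw [add_sub_cancel_left, ← inner_coordAdjoint, ← Finset.sum_sub_distrib,
        Finset.sum_eq_single k] at h1
      · simpa only [Pi.add_apply, Pi.single_eq_same] using h1
      · intro j _ hj
        simp [hj]
      · simp
    refine ⟨?_, ?_⟩
    -- The direction `v = g` yields `2‖g‖² ≤ λ‖g‖`.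
    · have h1 := key g
      have h2 := norm_add_le (m k) g
      rw [real_inner_self_eq_norm_sq] at h1
      rcases (norm_nonneg g).eq_or_lt with h0 | h0
      · rw [← h0]; positivity
      · refine le_of_mul_le_mul_right ?_ h0
        nlinarith
    -- Scaling `m k` by `2` and by `0` gives the two opposite inequalities.
    · have h1 := key (m k)
      have h2 := key (-m k)
      rw [← two_smul ℝ, norm_smul] at h1
      simp at h1 h2
      linarith
  · intro h m'
    rw [inner_map_eq_sum_coordAdjoint, Finset.mul_sum, ← Finset.sum_sub_distrib, Finset.mul_sum]
    refine Finset.sum_le_sum fun k _ => ?_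
    obtain ⟨h1, h2⟩ := h k
    have h3 := real_inner_le_norm (coordAdjoint B k (f - B m)) (m' k)
    have h4 := mul_le_mul_of_nonneg_right h1 (norm_nonneg (m' k))
    rw [Pi.sub_apply, inner_sub_right]
    linarith

theorem IsGroupLassoMin.norm_coordAdjoint_of_ne_zero {B : (ι → E) →L[ℝ] H} {lam : ℝ}
    (hlam : 0 < lam) {f : H} {m : ι → E} (h : IsGroupLassoMin B lam f m) {k : ι} (hk : m k ≠ 0) :
    ‖coordAdjoint B k (f - B m)‖ = lam / 2 := by
  obtain ⟨h1, h2⟩ := (isGroupLassoMin_iff_coordAdjoint hlam).1 h k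
  refine le_antisymm h1 (le_of_mul_le_mul_right ?_ (norm_pos_iff.2 hk))
  have h3 := real_inner_le_norm (coordAdjoint B k (f - B m)) (m k)
  linarith

/-- Strict complementarity holds for an open dense set of data. -/
theorem exists_isOpen_dense_strictComplementarity [FiniteDimensional ℝ E] {B : (ι → E) →L[ℝ] H}
    (hB : Function.Injective B) :
    ∃ O : Set (H × Ioi (0 : ℝ)), IsOpen O ∧ Dense O ∧ ∀ f lam, (f, lam) ∈ O →
      ∀ m, IsGroupLassoMin B lam f m →
        {k | ‖coordAdjoint B k (f - B m)‖ = lam / 2} = {k | m k ≠ 0} := by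
  choose sol hsol using fun p : H × Ioi (0 : ℝ) => exists_isGroupLassoMin B p.2.2 p.1
  obtain ⟨K, -, hK⟩ := B.toLinearMap.exists_antilipschitzWith (LinearMap.ker_eq_bot.2 hB)
  have hK' : ∀ m, ‖m‖ ≤ K * ‖B m‖ := fun m => by
    simpa [dist_eq_norm] using hK.le_mul_dist m 0
  have hsum : ∀ m : ι → E, ∑ k, ‖m k‖ ≤ (Fintype.card ι * K : ℝ) * ‖B m‖ := fun m => by
    calc ∑ k, ‖m k‖ ≤ ∑ _k : ι, ‖m‖ := Finset.sum_le_sum fun k _ => norm_le_pi_norm m k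
      _ = Fintype.card ι * ‖m‖ := by simp
      _ ≤ _ := by rw [mul_assoc]; gcongr; exact hK' m
  have hcont : Continuous sol := by
    rw [continuous_iff_continuousAt]
    intro p
    rw [ContinuousAt, tendsto_iff_norm_sub_tendsto_zero]
    refine squeeze_zero (g := fun q : H × Ioi (0 : ℝ) => (K : ℝ) * (‖q.1 - p.1‖ +
      (Fintype.card ι * K : ℝ) / 2 * |(q.2 : ℝ) - p.2|)) (fun _ => norm_nonneg _) (fun q => ?_) ?_
    · exact (hK' _).trans (mul_le_mul_of_nonneg_left
        ((hsol p).norm_map_sub_le (by positivity) hsum p.2.2 q.2.2 (hsol q)) K.2)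
    · exact Continuous.tendsto' (by fun_prop) _ _ (by simp)
  refine ⟨⋂ k, ({p | ‖coordAdjoint B k (p.1 - B (sol p))‖ < p.2 / 2} ∪ {p | sol p k ≠ 0}),
    isOpen_iInter_of_finite fun k => (isOpen_lt (by fun_prop) (by fun_prop)).union
      (isOpen_ne_fun (by fun_prop) (by fun_prop)), ?_, ?_⟩
  · rintro ⟨f, lam⟩
    set m := sol (f, lam) with hm
    have hmin : IsGroupLassoMin B lam f m := hsol (f, lam)
    have hlam : (0 : ℝ) < lam := lam.2
    classical
    let u : ι → E := fun k => if ‖coordAdjoint B k (f - B m)‖ = lam / 2 ∧ m k = 0 then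
      coordAdjoint B k (f - B m) else 0
    have hlim : Tendsto (fun t : ℝ => (f + B (t • u), lam)) (𝓝[>] 0) (𝓝 (f, lam)) := by
      refine tendsto_nhdsWithin_of_tendsto_nhds ?_
      exact Continuous.tendsto' (by fun_prop) _ _ (by simp)
    refine mem_closure_of_tendsto hlim ?_
    filter_upwards [self_mem_nhdsWithin] with t ht
    have ht : 0 < t := ht
    -- The residual is unchanged, so optimality only has to be rechecked where `u` is nonzero; there
    -- `m + t • u` is a positive multiple of `g k`.
    have hres : f + B (t • u) - B (m + t • u) = f - B m := by rw [map_add]; abel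
    have hmin' : IsGroupLassoMin B lam (f + B (t • u)) (m + t • u) := by
      rw [isGroupLassoMin_iff_coordAdjoint hlam, hres]
      intro k
      obtain ⟨h1, h2⟩ := (isGroupLassoMin_iff_coordAdjoint hlam).1 hmin k
      refine ⟨h1, ?_⟩
      by_cases hk : ‖coordAdjoint B k (f - B m)‖ = lam / 2 ∧ m k = 0
      · have : (m + t • u) k = t • coordAdjoint B k (f - B m) := by
          simp only [u, Pi.add_apply, Pi.smul_apply, if_pos hk]
          rw [hk.2, zero_add]
        rw [this, real_inner_smul_right, real_inner_self_eq_norm_sq, norm_smul,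
          Real.norm_of_nonneg ht.le, hk.1]
        ring
      · have : (m + t • u) k = m k := by
          simp only [u, Pi.add_apply, Pi.smul_apply, if_neg hk, smul_zero, add_zero]
        rw [this, h2]
    have heq : sol (f + B (t • u), lam) = m + t • u := (hsol (f + B (t • u), lam)).unique hB hlam hmin'
    refine mem_iInter.2 fun k => ?_
    simp only [mem_union, mem_ofPred_eq, heq, hres]
    obtain ⟨h1, -⟩ := (isGroupLassoMin_iff_coordAdjoint hlam).1 hmin k
    rcases h1.lt_or_eq with h1 | h1
    · exact Or.inl h1
    · refine Or.inr ?_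
      by_cases hk : m k = 0
      · have hne : coordAdjoint B k (f - B m) ≠ 0 := norm_pos_iff.1 (by rw [h1]; positivity)
        simp only [u, Pi.add_apply, Pi.smul_apply, h1, hk, and_self, if_true, zero_add]
        exact smul_ne_zero ht.ne' hne
      · simp only [u, Pi.add_apply, Pi.smul_apply, hk, and_false, if_false, smul_zero, add_zero]
        exact hk
  · intro f lam hO m hmin
    obtain rfl : m = sol (f, lam) := hmin.unique hB lam.2 (hsol (f, lam))
    ext k
    refine ⟨fun h => ?_, fun h => hmin.norm_coordAdjoint_of_ne_zero lam.2 h⟩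
    exact (mem_iInter.1 hO k).resolve_left (by simpa using (h : _ = _).ge)

end GroupLasso

/-! ### Integration against constant densities -/

section ConstantDensity

variable {X E : Type*} [MeasurableSpace X] [NormedAddCommGroup E] [InnerProductSpace ℝ E]
  [CompleteSpace E]

/-- Integration against the vector measure with constant density `v` with respect to `P`. -/
theorem integral_withDensityᵥ_const {P : Measure X} [IsFiniteMeasure P] (v : E) {φ : X → E}
    (hφ : Integrable φ P) :
    (P.withDensityᵥ fun _ => v).integral φ (innerSL ℝ) = inner ℝ (∫ x, φ x ∂P) v := by
  have hvar : (P.withDensityᵥ fun _ => v).variation = ‖v‖ₑ • P := by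
    rw [Measure.variation_withDensityᵥ (integrable_const v), withDensity_const]
  have hT := dominatedFinMeasAdditive_cbmApplyMeasure (P.withDensityᵥ fun _ => v) (innerSL ℝ)
  rw [hvar] at hT
  -- The variation `‖v‖ₑ • P` may vanish, but domination by a multiple of `P` suffices to integrate
  -- with respect to `P` instead.
  have hT := hT.of_smul_measure enorm_ne_top
  rw [VectorMeasure.integral_eq_setToFun, ← setToFun_congr_measure_of_integrable ‖v‖ₑ
    enorm_ne_top hvar.le hT _ φ hφ]
  refine Integrable.induction (fun φ => setToFun P _ hT φ = inner ℝ (∫ x, φ x ∂P) v) ?_ ?_ ?_ ?_ hφ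
  · intro c s hs hPs
    rw [setToFun_indicator_const hT hs hPs.ne, integral_indicator_const _ hs]
    change innerSL ℝ c ((P.withDensityᵥ fun _ => v) s) = _
    rw [withDensityᵥ_apply (integrable_const v) hs, setIntegral_const, innerSL_apply_apply,
      real_inner_smul_left, real_inner_smul_right]
  · intro f g _ hf hg ihf ihg
    rw [setToFun_add hT hf hg, ihf, ihg, integral_add' hf hg, inner_add_left]
  · exact isClosed_eq (continuous_setToFun hT)
      ((continuous_integral (μ := P) (G := E)).inner continuous_const)
  · intro f g hfg _ ih
    rw [← setToFun_congr_ae hT hfg, ih, integral_congr_ae hfg]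

end ConstantDensity

/-! ### Reduction of the measure problem to coefficients -/

variable {N : ℕ} {S : Set (Euc N)} {ι : Type*} [Fintype ι]

/-- Intersecting the pairwise separating sets concentrates each `ν k` on `E k`; the complements `(s
k j)ᶜ` make these sets disjoint. -/
theorem IsGenerating.exists_disjoint_supports {ν : ι → Measure S} (hν : IsGenerating ν) :
    ∃ E : ι → Set S, (∀ k, MeasurableSet (E k)) ∧ Pairwise (Function.onFun Disjoint E) ∧
      (∀ k, ν k (E k) = 1) ∧ ∀ j k, j ≠ k → ν j (E k) = 0 := by
  have := hν.prob
  choose s hs hs0 hs1 using fun j k (h : j ≠ k) => hν.singular h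
  have hmeas : ∀ k, MeasurableSet (⋂ j, ⋂ h : j ≠ k, s j k h ∩ (s k j h.symm)ᶜ) := fun k =>
    MeasurableSet.iInter fun j => MeasurableSet.iInter fun h => (hs _ _ _).inter (hs _ _ _).compl
  refine ⟨fun k => ⋂ j, ⋂ h : j ≠ k, s j k h ∩ (s k j h.symm)ᶜ, hmeas, ?_, ?_, ?_⟩
  · intro j k hjk
    refine Set.disjoint_left.2 fun x hx hx' => ?_
    exact (mem_iInter₂.1 hx k hjk.symm).2 (mem_iInter₂.1 hx' j hjk).1
  · intro k
    rw [← prob_compl_eq_zero_iff (hmeas k)]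
    simp only [compl_iInter, compl_inter, compl_compl, measure_iUnion_null_iff, measure_union_null_iff]
    exact fun j h => ⟨hs1 _ _ _, hs0 _ _ _⟩
  · intro j k h
    exact measure_mono_null (fun x hx => (mem_iInter₂.1 hx j h).1) (hs0 j k h)

/-- The triangle inequality gives `≤`; evaluating on the disjoint supports gives `≥`. -/
theorem variation_comb {ν : ι → Measure S} (hν : IsGenerating ν) (m : ι → Euc N) :
    (comb ν m).variation univ = ∑ k, ‖m k‖ₑ := by
  classical
  have := hν.prob
  apply le_antisymm
  · refine (VectorMeasure.variation_finsetSum_le _ _ _).trans (le_of_eq ?_)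
    rw [Measure.finsetSum_apply]
    refine Finset.sum_congr rfl fun k _ => ?_
    rw [Measure.variation_withDensityᵥ (integrable_const _), withDensity_const]
    simp
  · obtain ⟨E, hE, hdisj, hone, hzero⟩ := hν.exists_disjoint_supports
    calc ∑ k, ‖m k‖ₑ = ∑ k, ‖comb ν m (E k)‖ₑ := by
          refine Finset.sum_congr rfl fun k _ => ?_
          rw [comb_apply hν _ (hE k), Finset.sum_eq_single k]
          · simp [measureReal_def, hone]
          · intro j _ hj
            simp [measureReal_def, hzero j k hj]
          · simp
      _ ≤ ∑ k, (comb ν m).variation (E k) :=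
          Finset.sum_le_sum fun k _ => VectorMeasure.enorm_measure_le_variation _ _
      _ = (comb ν m).variation (⋃ k, E k) := by
          rw [measure_iUnion hdisj hE, tsum_fintype]
      _ ≤ (comb ν m).variation univ := measure_mono (subset_univ _)

theorem tvNorm_comb {ν : ι → Measure S} (hν : IsGenerating ν) (m : ι → Euc N) :
    tvNorm (comb ν m) = ∑ k, ‖m k‖ := by
  rw [tvNorm, variation_comb hν, ENNReal.toReal_sum fun _ _ => enorm_ne_top]
  simp

theorem comb_injective {ν : ι → Measure S} (hν : IsGenerating ν) :
    Function.Injective (comb ν) := by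
  intro m m' h
  have hsub : comb ν (m - m') = 0 := by
    have := comb_add hν (m - m') m'
    rwa [sub_add_cancel, h, right_eq_add] at this
  have h0 : tvNorm (comb ν (m - m')) = 0 := by
    rw [hsub, tvNorm, VectorMeasure.variation_zero]
    simp
  rw [tvNorm_comb hν, Finset.sum_eq_zero_iff_of_nonneg fun _ _ => norm_nonneg _] at h0
  exact funext fun k => sub_eq_zero.1 (norm_eq_zero.1 (h0 k (Finset.mem_univ k)))

theorem comb_single [DecidableEq ι] {ν : ι → Measure S} (k : ι) (v : Euc N) :
    comb ν (Pi.single k v) = (ν k).withDensityᵥ fun _ => v := by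
  rw [comb, Finset.sum_eq_single k]
  · simp
  · intro j _ hj
    rw [Pi.single_eq_of_ne hj]
    exact withDensityᵥ_zero
  · simp

variable {H : Type*} [NormedAddCommGroup H] [InnerProductSpace ℝ H]

/-- The restriction of `A` to the GSM space, in terms of the coefficients. -/
def coeffMap (A : VMeas S →ₗ[ℝ] H) {ν : ι → Measure S} (hν : IsGenerating ν) :
    (ι → Euc N) →L[ℝ] H :=
  LinearMap.toContinuousLinearMap
    (A ∘ₗ { toFun := comb ν, map_add' := comb_add hν, map_smul' := comb_smul hν })

@[simp]
theorem coeffMap_apply (A : VMeas S →ₗ[ℝ] H) {ν : ι → Measure S} (hν : IsGenerating ν)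
    (m : ι → Euc N) : coeffMap A hν m = A (comb ν m) := rfl

theorem isMinimizer_comb_iff {A : VMeas S →ₗ[ℝ] H} {ν : ι → Measure S} (hν : IsGenerating ν)
    {lam : ℝ} {f : H} {m : ι → Euc N} :
    IsMinimizer A (gsmSpace hν) lam f (comb ν m) ↔ IsGroupLassoMin (coeffMap A hν) lam f m := by
  have hobj : ∀ m, objective A lam f (comb ν m) = groupLasso (coeffMap A hν) lam f m := fun m => by
    rw [objective, groupLasso, tvNorm_comb hν, coeffMap_apply]
  constructor
  · intro h m'
    simpa only [hobj] using h.2 (comb ν m') ⟨m', rfl⟩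
  · intro h
    refine ⟨⟨m, rfl⟩, ?_⟩
    rintro _ ⟨m', rfl⟩
    simpa only [hobj] using h m'

/-- This translates the group-lasso optimality condition into `levelSet`: both sides have the same
inner product with every `v`, by pairing `A* h` with the density `v` against `ν k`. -/
theorem coordAdjoint_coeffMap [CompleteSpace H] [DecidableEq ι] [CompactSpace S]
    {A : VMeas S →ₗ[ℝ] H} (hA : WeakStarContinuous A) {ν : ι → Measure S} (hν : IsGenerating ν)
    (k : ι) (h : H) : coordAdjoint (coeffMap A hν) k h = ∫ x, adjoint hA h x ∂(ν k) := by
  have := hν.prob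
  refine ext_inner_right ℝ fun v => ?_
  rw [inner_coordAdjoint, coeffMap_apply, comb_single, ← pairing_adjoint hA]
  exact integral_withDensityᵥ_const v ((adjoint hA h).continuous.integrable_of_hasCompactSupport
    (HasCompactSupport.of_compactSpace _))

end TVReg

end

theorem theorem6p1 {N : ℕ} (S : Set (TVReg.Euc N)) [CompactSpace S]
    {H : Type*} [NormedAddCommGroup H] [InnerProductSpace ℝ H] [CompleteSpace H]
    (A : TVReg.VMeas S →ₗ[ℝ] H) (hA : TVReg.WeakStarContinuous A)
    {ι : Type*} [Fintype ι] (ν : ι → MeasureTheory.Measure S) (hν : TVReg.IsGenerating ν)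
    (hinj : Set.InjOn A (TVReg.gsmSpace hν)) :
    (∀ (f : H) (lam : ℝ), 0 < lam →
      ∃! m : ι → TVReg.Euc N,
        TVReg.IsMinimizer A (TVReg.gsmSpace hν) lam f (TVReg.comb ν m)) ∧
    ∃ O : Set (H × Set.Ioi (0 : ℝ)), O ∈ residual (H × Set.Ioi (0 : ℝ)) ∧ Dense O ∧
      ∀ (f : H) (lam : Set.Ioi (0 : ℝ)), (f, lam) ∈ O →
        ∀ m : ι → TVReg.Euc N,
          TVReg.IsMinimizer A (TVReg.gsmSpace hν) lam f (TVReg.comb ν m) →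
          TVReg.levelSet hA ν f ((lam : ℝ) / 2) (TVReg.comb ν m) = {k | m k ≠ 0} := by
  classical
  have hinj' : Function.Injective (TVReg.coeffMap A hν) := fun m m' h =>
    TVReg.comb_injective hν (hinj ⟨m, rfl⟩ ⟨m', rfl⟩ h)
  refine ⟨fun f lam hlam => ?_, ?_⟩
  · obtain ⟨m, hm⟩ := TVReg.exists_isGroupLassoMin (TVReg.coeffMap A hν) hlam f
    exact ⟨m, (TVReg.isMinimizer_comb_iff hν).2 hm, fun m' hm' =>
      ((TVReg.isMinimizer_comb_iff hν).1 hm').unique hinj' hlam hm⟩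
  · obtain ⟨O, hO, hdense, h⟩ := TVReg.exists_isOpen_dense_strictComplementarity hinj'
    refine ⟨O, residual_of_dense_open hO hdense, hdense, fun f lam hmem m hm => ?_⟩
    rw [← h f lam hmem m ((TVReg.isMinimizer_comb_iff hν).1 hm)]
    simp only [TVReg.levelSet, TVReg.coordAdjoint_coeffMap hA, TVReg.coeffMap_apply]
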